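/- All graphs are finite and simple. A realisation of a graph $G$ is a map $p\colon V(G)\to\mathbb{R}^2$; it is generic if its $2|V(G)|$ coordinates are algebraically independent over $\mathbb{Q}$. A continuous motion of $(G,p)$ is a continuous map $\phi\colon(-1,1)\times V(G)\to\mathbb{R}^2$, written $\phi_t(v)=\phi(t,v)$, such that $\phi_0=p$ and $\|\phi_t(u)-\phi_t(v)\|=\|p(u)-p(v)\|$ for every edge $uv\in E(G)$ and every $t\in(-1,1)$. It is trivial if the last equality holds for all $u,v\in V(G)$ and all $t\in(-1,1)$. The realisation $(G,p)$ is flexible if it has a non-trivial continuous motion, and the graph $G$ is flexible if its generic realisations are flexible. A NAC-colouring of $G$ is a surjective map $c\colon E(G)\to\{\mathrm{red},\mathrm{blue}\}$ such that every cycle of $G$ is either monochromatic or contains at least two red and at least two blue edges. Let $\mathrm{nac}(G)$ denote the number of NAC-colourings of $G$ divided by $2$. For $E'\subseteq E(G)$, let $G[E']$ be the subgraph formed by the edges in $E'$ and their end vertices. A separation of a graph $G$ without isolated vertices is a pair $\{G_1,G_2\}$ of subgraphs such that $G_1=G[E_1]$ and $G_2=G[E_2]$ for some partition $\{E_1,E_2\}$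 of $E(G)$ into two nonempty sets, $V(G_1)\setminus V(G_2)\neq\varnothing$ and $V(G_2)\setminus V(G_1)\neq\varnothing$. **Proposition.** Let $G$ be a connected flexible graph. Then $\mathrm{nac}(G)=1$ if and only if $G$ has a separation $\{G_1,G_2\}$ such that $G_1\cap G_2$ is a single vertex and $\mathrm{nac}(G_1)=\mathrm{nac}(G_2)=0$. -/

import Mathlib

namespace NACFlex

/-- A realisation of a graph with vertex set `V` in the plane: any map to `ℝ²` with its
Euclidean norm. -/
abbrev Realisation (V : Type*) : Type _ := V → EuclideanSpace ℝ (Fin 2)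

section Rigidity

variable {V : Type*}

/-- Two realisations of `G` are equivalent if all edges of `G` have equal lengths in both. -/
def EquivalentRealisations (G : SimpleGraph V) (p q : Realisation V) : Prop :=
  ∀ u v : V, G.Adj u v → ‖p u - p v‖ = ‖q u - q v‖

/-- Two realisations are congruent if all pairs of vertices have equal distances in both. -/
def CongruentRealisations (p q : Realisation V) : Prop :=
  ∀ u v : V, ‖p u - p v‖ = ‖q u - q v‖

/-- `φ` is a continuous motion of `(G, p)`, with time parameter in `(-1, 1)`: only the values
`φ t` for `t ∈ (-1, 1)` matter. -/
def IsContinuousMotion (G : SimpleGraph V) (p : Realisation V) (φ : ℝ → Realisation V) : Prop :=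
  ContinuousOn φ (Set.Ioo (-1) 1) ∧ φ 0 = p ∧
    ∀ t ∈ Set.Ioo (-1 : ℝ) 1, EquivalentRealisations G p (φ t)

/-- The realisation `(G, p)` is flexible: it has a continuous motion that is not trivial, that is,
along which not all realisations are congruent to `p`. -/
def IsFlexibleRealisation (G : SimpleGraph V) (p : Realisation V) : Prop :=
  ∃ φ : ℝ → Realisation V, IsContinuousMotion G p φ ∧
    ¬ ∀ t ∈ Set.Ioo (-1 : ℝ) 1, CongruentRealisations p (φ t)

/-- A realisation is generic if the family of all its coordinates is algebraically independent
over `ℚ`. -/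
def IsGeneric (p : Realisation V) : Prop :=
  AlgebraicIndependent ℚ (fun x : V × Fin 2 => p x.1 x.2)

/-- A graph is (2-)flexible if its generic realisations in the plane are flexible. -/
def IsFlexible (G : SimpleGraph V) : Prop :=
  ∀ p : Realisation V, IsGeneric p → IsFlexibleRealisation G p

end Rigidity

section Colourings

variable {V : Type*}

/-- The number of edges of colour `b` on the walk `w` (each edge counted once). -/
noncomputable def colourCount {G : SimpleGraph V} (c : G.edgeSet → Bool) {u v : V}
    (w : G.Walk u v) (b : Bool) : ℕ :=
  Set.ncard {e : G.edgeSet | (e : Sym2 V) ∈ w.edges ∧ c e = b}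

/-- A NAC-colouring of `G`: an edge colouring with the two colours `true` (red) and `false` (blue)
which is surjective and such that every cycle is either monochromatic or contains at least two red
and two blue edges. -/
def IsNACColouring (G : SimpleGraph V) (c : G.edgeSet → Bool) : Prop :=
  Function.Surjective c ∧
    ∀ (v : V) (w : G.Walk v v), w.IsCycle →
      (∃ b : Bool, ∀ e : G.edgeSet, (e : Sym2 V) ∈ w.edges → c e = b) ∨
      (2 ≤ colourCount c w true ∧ 2 ≤ colourCount c w false)

/-- The number of NAC-colourings of a (finite) graph, divided by two. -/
noncomputable def nnac (G : SimpleGraph V) : ℚ :=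
  (Nat.card {c : G.edgeSet → Bool // IsNACColouring G c} : ℚ) / 2

end Colourings

section Separations

variable {V : Type*}

/-- The edge-induced subgraph `G[E']` : its edges are the edges of `G` in `E'`, its vertices are
the end vertices of these edges. -/
def edgeInduced (G : SimpleGraph V) (E' : Set (Sym2 V)) : G.Subgraph where
  verts := {u | ∃ v, G.Adj u v ∧ s(u, v) ∈ E'}
  Adj u v := G.Adj u v ∧ s(u, v) ∈ E'
  adj_sub h := h.1
  edge_vert {_ v} h := ⟨v, h⟩
  symm := ⟨fun u v h => ⟨h.1.symm, by rw [Sym2.eq_swap]; exact h.2⟩⟩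

/-- `{G₁, G₂}` is a separation of `G` (a graph without isolated vertices). -/
def IsSeparation (G : SimpleGraph V) (G₁ G₂ : G.Subgraph) : Prop :=
  (∃ E₁ E₂ : Set (Sym2 V), E₁.Nonempty ∧ E₂.Nonempty ∧ Disjoint E₁ E₂ ∧ E₁ ∪ E₂ = G.edgeSet ∧
      G₁ = edgeInduced G E₁ ∧ G₂ = edgeInduced G E₂) ∧
    (G₁.verts \ G₂.verts).Nonempty ∧ (G₂.verts \ G₁.verts).Nonempty

end Separations

end NACFlex

/-! Suppose the NAC-colouring is unique up to swapping colours, and follow a non-trivial motion of a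
generic realisation, with the plane identified with ℂ. If the quotient of two edge vectors varies,
it takes infinitely many values, so along a suitable ultrafilter its germ is transcendental over ℂ.
A valuation that is trivial on ℂ and less than one on this germ yields a NAC-colouring separating
the two edges (`exists_nac_of_infinite_ratio`). By uniqueness, edges of equal colour therefore keep
a constant quotient: red edges rotate by a common R(t), blue ones by B(t), and R(t) ≠ B(t) for some
t.

Around a closed walk the red and blue displacements sum to zero both before and after these
rotations, so the red sum alone vanishes. Its real part is a rational linear relation among generic
coordinates. If a vertex v has a red and a blue edge whose other ends are joined by a walk avoiding
v, the resulting closed walk gives v a nonzero coefficient, a contradiction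
(`colour_eq_of_unique_nac`). By connectedness some vertex meets both colours, and it is thus a cut
vertex.

The rest is combinatorial. Cycles of a one-vertex sum lie in one part, so colouring the parts
differently is a NAC-colouring, and a NAC-colouring of one part extends to the whole graph. Hence
uniqueness up to swapping is equivalent to neither part having a NAC-colouring. -/

/-! ### Valuations, ultrafilters and germs -/

open Polynomial in
/-- A transcendental element is a nonunit of some valuation subring containing the constants. -/
theorem Transcendental.exists_valuationSubring {F K : Type*} [Field F] [Field K] [Algebra F K]
    {h : K} (hh : Transcendental F h) :
    ∃ V : ValuationSubring K, (∀ c : F, algebraMap F K c ∈ V) ∧ h ∈ V.nonunits := by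
  let A := (Algebra.adjoin F {h}).toSubring
  let x : A := ⟨h, Algebra.subset_adjoin rfl⟩
  have hx : Ideal.span {x} ≠ ⊤ := by
    rw [Ne, Ideal.span_singleton_eq_top, isUnit_iff_exists_inv]
    rintro ⟨⟨b, hb⟩, hxb⟩
    obtain ⟨P, hP⟩ : ∃ P : F[X], Polynomial.aeval h P = b := by
      have hb' : b ∈ Algebra.adjoin F {h} := hb
      rwa [Algebra.adjoin_singleton_eq_range_aeval] at hb'
    have h1 : h * b = 1 := congrArg Subtype.val hxb
    -- This polynomial is nonzero because its value at 0 is -1.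
    refine hh ⟨X * P - 1, fun h0 => ?_, by simp [hP, h1]⟩
    simpa using congrArg (Polynomial.eval 0) h0
  obtain ⟨V, hV, hV'⟩ := Ideal.image_subset_nonunits_valuationSubring _ hx
  exact ⟨V, fun c => hV ((Algebra.adjoin F {h}).algebraMap_mem c),
    hV' ⟨x, Ideal.subset_span rfl, rfl⟩⟩

open Filter in
/-- A function with infinitely many values on `T` avoids every finite set along some
ultrafilter on `T`. -/
theorem Set.Infinite.exists_ultrafilter {α β : Type*} {h : α → β} {T : Set α}
    (hT : (h '' T).Infinite) :
    ∃ U : Ultrafilter α, T ∈ U ∧ ∀ S : Set β, S.Finite → ∀ᶠ t in (U : Filter α), h t ∉ S := by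
  have hne : (comap h cofinite ⊓ 𝓟 T).NeBot := by
    rw [inf_principal_neBot_iff]
    intro s hs
    obtain ⟨C, hC, hCs⟩ := mem_comap.1 hs
    obtain ⟨y, ⟨t, ht, rfl⟩, hy⟩ := hT.exists_notMem_finite (mem_cofinite.1 hC)
    exact ⟨t, hCs (by simpa using hy), ht⟩
  refine ⟨Ultrafilter.of (comap h cofinite ⊓ 𝓟 T), ?_, fun S hS => ?_⟩
  · exact Ultrafilter.of_le _ (mem_inf_of_right (mem_principal_self T))
  · have hS' : Sᶜ ∈ (cofinite : Filter β) := mem_cofinite.2 (by simpa using hS)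
    exact Ultrafilter.of_le _ (mem_inf_of_left (preimage_mem_comap hS'))

open Filter in
/-- Constants as a ring homomorphism into germs. -/
def germConst {α : Type*} (l : Filter α) (R : Type*) [CommRing R] : R →+* Germ l R where
  toFun c := (↑c : Germ l R)
  map_one' := rfl
  map_zero' := rfl
  map_mul' _ _ := rfl
  map_add' _ _ := rfl

open Filter Polynomial in
theorem eval₂_germConst {α R : Type*} [CommRing R] (l : Filter α) (h : α → R) (P : R[X]) :
    P.eval₂ (germConst l R) (↑h : Germ l R) = ((fun t => P.eval (h t) : α → R) : Germ l R) := by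
  induction P using Polynomial.induction_on' with
  | add p q hp hq => rw [eval₂_add, hp, hq, ← Germ.coe_add]; congr 1; ext t; simp
  | monomial n a =>
    rw [eval₂_monomial, ← Germ.coe_pow]
    change ((fun _ => a : α → R) : Germ l R) * _ = _
    rw [← Germ.coe_mul]; congr 1; ext t; simp

/-! ### NAC-colourings from pairs of equivalence relations -/

namespace SimpleGraph
variable {V : Type*} {G : SimpleGraph V}

/-- If all edges but one of a trail with related ends are related, so is the remaining one. -/
theorem Walk.setoid_rel_of_forall_ne (r : Setoid V) {a b : V} :
    ∀ {u v : V} (p : G.Walk u v), p.edges.Nodup → s(a, b) ∈ p.edges → r u v →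
      (∀ x y, s(x, y) ∈ p.edges → s(x, y) ≠ s(a, b) → r x y) → r a b
  | _, _, .nil, _, h, _, _ => by simp at h
  | u, v, .cons (v := x) hux q, hn, hab, huv, hall => by
    rw [Walk.edges_cons, List.nodup_cons] at hn
    have hq : ∀ {y z : V} (q : G.Walk y z), (∀ x y, s(x, y) ∈ q.edges → r x y) → r y z := by
      intro y z q hq
      induction q with
      | nil => exact r.refl _
      | cons h q ih =>
        exact r.trans (hq _ _ (by simp)) (ih fun x y h => hq x y (by simp [h]))
    by_cases hg : s(u, x) = s(a, b)
    · have hxv : r x v := hq q fun y z hyz => hall y z (by simp [hyz]) fun h =>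
        hn.1 (hg.trans h.symm ▸ hyz)
      have hux' : r u x := r.trans huv (r.symm hxv)
      rcases Sym2.eq_iff.1 hg with ⟨rfl, rfl⟩ | ⟨rfl, rfl⟩
      · exact hux'
      · exact r.symm hux'
    · have hux' : r u x := hall u x (by simp) hg
      have hab' : s(a, b) ∈ q.edges := by
        rw [Walk.edges_cons, List.mem_cons] at hab
        exact hab.resolve_left fun h => hg h.symm
      exact setoid_rel_of_forall_ne r q hn.2 hab' (r.trans (r.symm hux') huv)
        fun y z h => hall y z (by simp [h])

end SimpleGraph

namespace NACFlex
variable {V : Type*} {G : SimpleGraph V}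

/-- If `e` were the only edge of colour `b` on the cycle, the other edges would join its ends by
`r`-related steps, making the ends of `e` related. -/
theorem exists_two_of_setoid (r : Setoid V) (c : G.edgeSet → Bool) (b : Bool)
    (hc : ∀ u v (h : G.Adj u v), c ⟨s(u, v), h⟩ ≠ b → r u v)
    (hc' : ∀ u v (h : G.Adj u v), c ⟨s(u, v), h⟩ = b → ¬ r u v)
    {v : V} (w : G.Walk v v) (hw : w.IsCycle) (e : G.edgeSet) (he : (e : Sym2 V) ∈ w.edges)
    (hb : c e = b) : 2 ≤ colourCount c w b := by
  have hfin : {e : G.edgeSet | (e : Sym2 V) ∈ w.edges ∧ c e = b}.Finite :=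
    Set.Finite.subset ((List.finite_toSet w.edges).preimage Subtype.val_injective.injOn)
      fun e he => he.1
  rw [colourCount]
  by_contra hlt
  have hsub : ∀ f : G.edgeSet, (f : Sym2 V) ∈ w.edges → c f = b → f = e := by
    intro f hf hfb
    by_contra hne
    exact hlt ((Set.one_lt_ncard_iff hfin).2 ⟨f, e, ⟨hf, hfb⟩, ⟨he, hb⟩, hne⟩)
  obtain ⟨e, heG⟩ := e
  induction e with
  | h x y =>
    refine hc' x y heG hb (w.setoid_rel_of_forall_ne r hw.edges_nodup he (r.refl _) ?_)
    intro a z haz hne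
    have hadj := w.edges_subset_edgeSet haz
    exact hc a z hadj fun h => hne (congrArg Subtype.val (hsub ⟨_, hadj⟩ haz h))

/-- A surjective colouring is a NAC-colouring if adjacent vertices are joined by an edge of one
colour when related by `r₁`, and of the other colour when related by `r₂`. -/
theorem isNACColouring_of_setoids (r₁ r₂ : Setoid V) (c : G.edgeSet → Bool)
    (hs : Function.Surjective c)
    (h₁ : ∀ u v (h : G.Adj u v), c ⟨s(u, v), h⟩ = true ↔ r₁ u v)
    (h₂ : ∀ u v (h : G.Adj u v), c ⟨s(u, v), h⟩ = false ↔ r₂ u v) : IsNACColouring G c := by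
  refine ⟨hs, fun v w hw => or_iff_not_imp_left.2 fun hmono => ?_⟩
  have hex : ∀ b : Bool, ∃ e : G.edgeSet, (e : Sym2 V) ∈ w.edges ∧ c e = b := by
    intro b
    by_contra! hb
    exact hmono ⟨!b, fun e he => Bool.eq_not.2 (hb e he)⟩
  obtain ⟨e, he, hce⟩ := hex true
  obtain ⟨f, hf, hcf⟩ := hex false
  constructor
  · refine exists_two_of_setoid r₂ c true ?_ ?_ w hw e he hce
    · intro u v h hc; exact (h₂ u v h).1 (by simpa using hc)
    · intro u v h hc hr; simp [(h₂ u v h).2 hr] at hc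
  · refine exists_two_of_setoid r₁ c false ?_ ?_ w hw f hf hcf
    · intro u v h hc; exact (h₁ u v h).1 (by simpa using hc)
    · intro u v h hc hr; simp [(h₁ u v h).2 hr] at hc

end NACFlex
-- Generic realisations, and NAC-colourings from motions
-- With a finite transcendence basis over ℚ, ℝ would be algebraic over a countable ring and hence
-- countable.
theorem exists_algebraicIndependent_real (ι : Type*) [Finite ι] :
    ∃ x : ι → ℝ, AlgebraicIndependent ℚ x := by
  obtain ⟨κ, x, hx⟩ := exists_isTranscendenceBasis' ℚ ℝ
  have hκ : Infinite κ := by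
    by_contra hfin
    rw [not_infinite_iff_finite] at hfin
    have halg := hx.isAlgebraic
    have hle := Algebra.IsAlgebraic.cardinalMk_le_max (Algebra.adjoin ℚ (Set.range x)) ℝ
    have hcount : Cardinal.mk (Algebra.adjoin ℚ (Set.range x)) ≤ Cardinal.aleph0 := by
      rw [← Cardinal.mk_congr hx.1.aevalEquiv.toEquiv]
      exact MvPolynomial.cardinalMk_le_max.trans (by simp)
    rw [max_eq_right hcount, Cardinal.mk_real] at hle
    exact absurd hle Cardinal.aleph0_lt_continuum.not_ge
  obtain ⟨n, ⟨e⟩⟩ := Finite.exists_equiv_fin ι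
  obtain ⟨f⟩ : Nonempty (ι ↪ κ) := ⟨e.toEmbedding.trans
    (Fin.valEmbedding.trans (Infinite.natEmbedding κ))⟩
  exact ⟨x ∘ f, hx.1.comp f f.injective⟩

/-- Congruence modulo an additive subgroup, of the values of a function. -/
def AddSubgroup.diffSetoid {V K : Type*} [AddCommGroup K] (S : AddSubgroup K) (x : V → K) :
    Setoid V where
  r u v := x u - x v ∈ S
  iseqv := ⟨fun u => by simp, fun {u v} h => by simpa using S.neg_mem h,
    fun {u v w} h h' => by simpa using S.add_mem h h'⟩

namespace NACFlex

open Filter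

theorem exists_generic (V : Type*) [Finite V] : ∃ p : Realisation V, IsGeneric p := by
  obtain ⟨x, hx⟩ := exists_algebraicIndependent_real (V × Fin 2)
  exact ⟨fun v => WithLp.toLp 2 fun i => x (v, i), hx⟩

/-- Edges are coloured according to whether the valuation of their difference is at most that of
a given edge. -/
theorem exists_nac_of_valuation {V K Γ : Type*} {G : SimpleGraph V} [Field K]
    [LinearOrderedCommGroupWithZero Γ] (val : Valuation K Γ) (x y : V → K)
    (hxy : ∀ u v, G.Adj u v → val (x u - x v) * val (y u - y v) = 1)
    {a b a' b' : V} (h : G.Adj a b) (h' : G.Adj a' b')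
    (hlt : val (x a - x b) < val (x a' - x b')) :
    ∃ c, IsNACColouring G c ∧ c ⟨s(a, b), h⟩ ≠ c ⟨s(a', b'), h'⟩ := by
  classical
  set α := val (x a - x b) with hα
  have hα0 : α ≠ 0 := left_ne_zero_of_mul_eq_one (hxy a b h)
  -- Valuation balls are additive subgroups. As the valuations of the two differences along an edge
  -- are inverse to each other, the first exceeds `α` exactly when the second is below `α⁻¹`; hence
  -- one ball is closed and the other open.
  let S₁ : AddSubgroup K :=
    { carrier := {z | val z ≤ α}
      zero_mem' := by simp
      add_mem' := fun hz hz' => (val.map_add _ _).trans (max_le hz hz')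
      neg_mem' := fun {z} hz => by simpa using hz }
  let S₂ : AddSubgroup K :=
    { carrier := {z | val z < α⁻¹}
      zero_mem' := by simpa [zero_lt_iff] using hα0
      add_mem' := fun hz hz' => (val.map_add _ _).trans_lt (max_lt hz hz')
      neg_mem' := fun {z} hz => by simpa using hz }
  let r₁ : Setoid V := S₁.diffSetoid x
  let r₂ : Setoid V := S₂.diffSetoid y
  let c : G.edgeSet → Bool := fun e => decide (∀ u v, (e : Sym2 V) = s(u, v) → r₁ u v)
  have h₁ : ∀ u v (h : G.Adj u v), c ⟨s(u, v), h⟩ = true ↔ r₁ u v := by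
    intro u v h
    simp only [c, decide_eq_true_eq]
    refine ⟨fun H => H u v rfl, fun H u' v' he => ?_⟩
    rcases Sym2.eq_iff.1 he with ⟨rfl, rfl⟩ | ⟨rfl, rfl⟩
    · exact H
    · exact r₁.symm H
  have h₁₂ : ∀ u v, G.Adj u v → (r₂ u v ↔ ¬ r₁ u v) := by
    intro u v h
    have hX := left_ne_zero_of_mul_eq_one (hxy u v h)
    change val (y u - y v) < α⁻¹ ↔ ¬ val (x u - x v) ≤ α
    rw [eq_inv_of_mul_eq_one_right (hxy u v h),
      inv_lt_inv₀ (zero_lt_iff.2 hX) (zero_lt_iff.2 hα0), not_le]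
  have hca : c ⟨s(a, b), h⟩ = true := (h₁ _ _ _).2 (le_refl α)
  have hcb : c ⟨s(a', b'), h'⟩ = false := by
    rw [← Bool.not_eq_true, h₁]
    exact not_le.2 hlt
  refine ⟨c, isNACColouring_of_setoids r₁ r₂ c ?_ h₁ ?_, by simp [hca, hcb]⟩
  · rintro (_ | _)
    exacts [⟨_, hcb⟩, ⟨_, hca⟩]
  · intro u v h
    rw [← Bool.not_eq_true, h₁, h₁₂ u v h]

/-- If the relative position of two edges takes infinitely many values during a motion, then some
NAC-colouring separates them. -/
theorem exists_nac_of_infinite_ratio {V : Type*} {G : SimpleGraph V} (ψ : ℝ → V → ℂ) (T : Set ℝ)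
    (ℓ : V → V → ℝ) (hℓ : ∀ u v, G.Adj u v → ℓ u v ≠ 0)
    (hψ : ∀ t ∈ T, ∀ u v, G.Adj u v → ‖ψ t u - ψ t v‖ = ℓ u v)
    {a b a' b' : V} (h : G.Adj a b) (h' : G.Adj a' b')
    (hinf : ((fun t => (ψ t a - ψ t b) / (ψ t a' - ψ t b')) '' T).Infinite) :
    ∃ c, IsNACColouring G c ∧ c ⟨s(a, b), h⟩ ≠ c ⟨s(a', b'), h'⟩ := by
  obtain ⟨U, hTU, hU⟩ := hinf.exists_ultrafilter
  let K := Germ (U : Filter ℝ) ℂ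
  let _ : Algebra ℂ K := (germConst (U : Filter ℝ) ℂ).toAlgebra
  let H : ℝ → ℂ := fun t => (ψ t a - ψ t b) / (ψ t a' - ψ t b')
  let x : V → K := fun v => ((fun t => ψ t v : ℝ → ℂ) : Germ (U : Filter ℝ) ℂ)
  let y : V → K := fun v => ((fun t => star (ψ t v) : ℝ → ℂ) : Germ (U : Filter ℝ) ℂ)
  -- A polynomial annihilating the germ would vanish at `H t` for `U`-almost all `t`, but `U` makes
  -- `H` avoid its finite root set.
  have htr : Transcendental ℂ ((H : Germ (U : Filter ℝ) ℂ) : K) := by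
    rintro ⟨P, hP0, hP⟩
    rw [Polynomial.aeval_def] at hP
    have hP' := (eval₂_germConst (U : Filter ℝ) H P).symm.trans hP
    have hev : ∀ᶠ t in (U : Filter ℝ), P.eval (H t) = 0 := Germ.coe_eq.1 hP'
    obtain ⟨t, ht, ht'⟩ := (hev.and (hU _ (Polynomial.finite_setOfPred_isRoot hP0))).exists
    exact ht' ht
  obtain ⟨A, hA, hHA⟩ := htr.exists_valuationSubring
  -- Both `z` and `z⁻¹` lie in `A`, so the valuation is trivial on constants.
  have hconst : ∀ z : ℂ, z ≠ 0 → A.valuation (algebraMap ℂ K z) = 1 := by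
    intro z hz
    refine le_antisymm ((A.valuation_le_one_iff _).2 (hA z)) ?_
    have h1 := (A.valuation_le_one_iff _).2 (hA z⁻¹)
    rw [map_inv₀, map_inv₀] at h1
    refine (inv_le_one₀ (zero_lt_iff.2 ?_)).1 h1
    simpa using hz
  -- The product of an edge vector and its conjugate is the squared edge length, a nonzero constant
  -- along the motion.
  have hxy : ∀ u v, G.Adj u v → A.valuation (x u - x v) * A.valuation (y u - y v) = 1 := by
    intro u v huv
    rw [← map_mul, ← hconst ((ℓ u v : ℂ) ^ 2) (by simpa using hℓ u v huv)]
    congr 1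
    refine Germ.coe_eq.2 ?_
    filter_upwards [hTU] with t ht
    rw [← hψ t ht u v huv]
    rw [← star_sub]
    exact Complex.mul_conj' _
  have hx' : x a' - x b' ≠ 0 := fun h0 => by simpa [h0] using hxy a' b' h'
  refine exists_nac_of_valuation A.valuation x y hxy h h' ?_
  have hH : ((H : Germ (U : Filter ℝ) ℂ) : K) = (x a - x b) / (x a' - x b') := rfl
  rw [A.mem_nonunits_iff, hH, map_div₀, div_lt_one₀] at hHA
  · exact hHA
  · exact zero_lt_iff.2 (by simpa using hx')

end NACFlex
-- Coloured sums over walks, and the rotation argument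
namespace SimpleGraph.Walk
variable {V M : Type*} {G : SimpleGraph V} [AddCommGroup M]

/-- The sum of the differences of `f` along the steps of a walk, with weights `k`. -/
def weightedSum (k : V → V → ℤ) (f : V → M) : ∀ {u v : V}, G.Walk u v → M
  | _, _, .nil => 0
  | u, _, .cons (v := x) _ p => k u x • (f u - f x) + p.weightedSum k f

theorem map_weightedSum {N : Type*} [AddCommGroup N] (k : V → V → ℤ) (f : V → M) (g : M →+ N)
    {u v : V} (p : G.Walk u v) : g (p.weightedSum k f) = p.weightedSum k (fun x => g (f x)) := by
  induction p with
  | nil => simp [weightedSum]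
  | cons h p ih => simp [weightedSum, ih]

/-- The coefficients are taken in ℚ so that linear independence over ℚ can be applied to them. -/
theorem weightedSum_eq_sum [Fintype V] [DecidableEq V] (k : V → V → ℤ) (f : V → ℝ)
    {u v : V} (p : G.Walk u v) :
    p.weightedSum k f = ∑ x, p.weightedSum k (Pi.single x (1 : ℚ)) • f x := by
  induction p with
  | nil => simp [weightedSum]
  | @cons u w v h p ih =>
    simp only [weightedSum, ih, add_smul, Finset.sum_add_distrib, add_left_inj]
    simp [Pi.single_apply, Rat.smul_def, mul_assoc, sub_mul, ← Finset.mul_sum,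
      apply_ite (Rat.cast : ℚ → ℝ)]

theorem weightedSum_single_eq_zero [DecidableEq V] (k : V → V → ℤ) (m : M) {x u v : V}
    (p : G.Walk u v) (hx : x ∉ p.support) : p.weightedSum k (Pi.single x m) = 0 := by
  induction p with
  | nil => rfl
  | cons h p ih =>
    rw [support_cons, List.mem_cons, not_or] at hx
    have hx' : x ≠ _ := fun h' => hx.2 (h' ▸ p.start_mem_support)
    simp [weightedSum, ih hx.2, Ne.symm hx.1, Ne.symm hx']

end SimpleGraph.Walk

namespace NACFlex
variable {V : Type*} {G : SimpleGraph V}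

/-- The weight one on edges with colour `true` and zero on other pairs. -/
noncomputable def redWeight (c : G.edgeSet → Bool) (u v : V) : ℤ :=
  open Classical in if ∃ h : G.Adj u v, c ⟨s(u, v), h⟩ = true then 1 else 0

theorem redWeight_of_adj (c : G.edgeSet → Bool) {u v : V} (h : G.Adj u v) :
    redWeight c u v = if c ⟨s(u, v), h⟩ = true then 1 else 0 := by
  simp [redWeight, h]

/-- If the red sum of positions over every closed walk vanishes for a generic realisation, then
two edges at `v` whose other ends are joined by a walk avoiding `v` have the same colour. -/
theorem colour_eq_of_weightedSum_eq_zero [Finite V] {p : Realisation V} (hp : IsGeneric p)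
    (c : G.edgeSet → Bool)
    (h0 : ∀ u (w : G.Walk u u), w.weightedSum (redWeight c) (fun v => p v 0) = 0)
    {v u w : V} (hu : G.Adj v u) (hw : G.Adj v w) (q : G.Walk u w) (hq : v ∉ q.support) :
    c ⟨s(v, u), hu⟩ = c ⟨s(v, w), hw⟩ := by
  classical
  have := Fintype.ofFinite V
  have hlin : LinearIndependent ℚ (fun v => p v 0) :=
    hp.linearIndependent.comp (fun v : V => (v, (0 : Fin 2))) fun a b h => congrArg Prod.fst h
  -- This closed walk goes from `w` through `v` to `u` and back along `q`, so it meets `v` once. The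
  -- coefficient of `p v 0` is then the red weight of `vu` minus that of `vw`.
  have h1 := h0 w (.cons hw.symm (.cons hu q))
  rw [SimpleGraph.Walk.weightedSum_eq_sum] at h1
  have h2 := Fintype.linearIndependent_iff.1 hlin _ h1 v
  have hsw : (⟨s(w, v), hw.symm⟩ : G.edgeSet) = ⟨s(v, w), hw⟩ := Subtype.ext Sym2.eq_swap
  simp only [SimpleGraph.Walk.weightedSum, q.weightedSum_single_eq_zero _ _ hq,
    redWeight_of_adj c hu, redWeight_of_adj c hw.symm, hsw, Pi.single_apply, hu.ne', hw.ne'] at h2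
  by_contra hne
  cases h3 : c ⟨s(v, u), hu⟩ <;> cases h4 : c ⟨s(v, w), hw⟩ <;> simp_all

theorem IsGeneric.injective {p : Realisation V} (hp : IsGeneric p) : Function.Injective p := by
  intro u v h
  have huv : (u, (0 : Fin 2)) = (v, 0) := AlgebraicIndependent.injective hp (by simp [h])
  exact congrArg Prod.fst huv

/-- If all edges of the same colour rotate together, a non-trivial motion rotates the two colours
differently, so the red sum over closed walks vanishes. -/
theorem weightedSum_eq_zero_of_rotation (ψ₀ ψ₁ : V → ℂ) (c : G.edgeSet → Bool) (R B : ℂ)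
    (hRB : R ≠ B)
    (hψ : ∀ u v (h : G.Adj u v), ψ₁ u - ψ₁ v =
      (if c ⟨s(u, v), h⟩ = true then R else B) * (ψ₀ u - ψ₀ v))
    {u : V} (w : G.Walk u u) : w.weightedSum (redWeight c) ψ₀ = 0 := by
  -- The blue sum is the total displacement minus the red sum. On a closed walk both total
  -- displacements vanish, leaving `R - B` times the red sum.
  have key : ∀ {u v : V} (w : G.Walk u v), ψ₁ u - ψ₁ v =
      R * w.weightedSum (redWeight c) ψ₀ +
        B * ((ψ₀ u - ψ₀ v) - w.weightedSum (redWeight c) ψ₀) := by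
    intro u v w
    induction w with
    | nil => simp [SimpleGraph.Walk.weightedSum]
    | @cons u x v h p ih =>
      rw [← sub_add_sub_cancel (ψ₁ u) (ψ₁ x) (ψ₁ v), ih, hψ u x h, SimpleGraph.Walk.weightedSum,
        redWeight_of_adj c h]
      split_ifs <;> simp <;> ring
  have h := key w
  have h' : (R - B) * w.weightedSum (redWeight c) ψ₀ = 0 := by linear_combination -h
  exact (mul_eq_zero.1 h').resolve_left (sub_ne_zero.2 hRB)

/-- If a NAC-colouring is unique up to swapping the colours and the graph is flexible, then two
edges at `v` whose other ends are joined by a walk avoiding `v` have the same colour. -/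
theorem colour_eq_of_unique_nac [Finite V] (hconn : G.Connected) (hflex : IsFlexible G)
    (c : G.edgeSet → Bool) (hc : Function.Surjective c)
    (huniq : ∀ c', IsNACColouring G c' → c' = c ∨ c' = fun e => !c e)
    {v u w : V} (hu : G.Adj v u) (hw : G.Adj v w) (q : G.Walk u w) (hq : v ∉ q.support) :
    c ⟨s(v, u), hu⟩ = c ⟨s(v, w), hw⟩ := by
  obtain ⟨p, hp⟩ := exists_generic V
  obtain ⟨φ, ⟨hcont, hφ0, hφ⟩, hnt⟩ := hflex p hp
  refine colour_eq_of_weightedSum_eq_zero hp c ?_ hu hw q hq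
  let L : EuclideanSpace ℝ (Fin 2) ≃ₗᵢ[ℝ] ℂ := Complex.orthonormalBasisOneI.repr.symm
  let ψ : ℝ → V → ℂ := fun t v => L (φ t v)
  have hLre : ∀ z, (L z).re = z 0 := by
    intro z
    simp [L]
  have hnorm : ∀ t u v, ‖ψ t u - ψ t v‖ = ‖φ t u - φ t v‖ := by
    intro t u v
    rw [← map_sub, L.norm_map]
  have hψ : ∀ t ∈ Set.Ioo (-1 : ℝ) 1, ∀ u v, G.Adj u v → ‖ψ t u - ψ t v‖ = ‖p u - p v‖ := by
    intro t ht u v h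
    rw [hnorm, hφ t ht u v h]
  have hne : ∀ u v, G.Adj u v → ‖p u - p v‖ ≠ 0 := fun u v h => by
    simpa [sub_eq_zero] using hp.injective.ne h.ne
  have hψne : ∀ t ∈ Set.Ioo (-1 : ℝ) 1, ∀ u v, G.Adj u v → ψ t u - ψ t v ≠ 0 := by
    intro t ht u v h h0
    apply hne u v h
    rw [← hψ t ht u v h, h0, norm_zero]
  have h0mem : (0 : ℝ) ∈ Set.Ioo (-1 : ℝ) 1 := by simp
  have hψc : ∀ v, ContinuousOn (fun t => ψ t v) (Set.Ioo (-1) 1) := fun v =>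
    L.continuous.comp_continuousOn ((continuous_apply v).comp_continuousOn hcont)
  -- A non-constant quotient has a connected image with two points, hence an infinite one, which
  -- gives a NAC-colouring separating the two edges. Neither `c` nor its complement does so.
  have hconst : ∀ a b a' b' (h : G.Adj a b) (h' : G.Adj a' b'),
      c ⟨s(a, b), h⟩ = c ⟨s(a', b'), h'⟩ → ∀ t ∈ Set.Ioo (-1 : ℝ) 1,
      (ψ t a - ψ t b) / (ψ t a' - ψ t b') = (ψ 0 a - ψ 0 b) / (ψ 0 a' - ψ 0 b') := by
    intro a b a' b' h h' hcc t ht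
    by_contra hne'
    have hpre : IsPreconnected
        ((fun t => (ψ t a - ψ t b) / (ψ t a' - ψ t b')) '' Set.Ioo (-1 : ℝ) 1) := by
      refine isPreconnected_Ioo.image _ ?_
      exact ((hψc a).sub (hψc b)).div ((hψc a').sub (hψc b')) fun t ht => hψne t ht _ _ h'
    have hinf := hpre.infinite_of_nontrivial ⟨_, ⟨t, ht, rfl⟩, _, ⟨0, h0mem, rfl⟩, hne'⟩
    obtain ⟨c', hc', hne''⟩ := exists_nac_of_infinite_ratio ψ _ _ hne hψ h h' hinf
    rcases huniq c' hc' with rfl | rfl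
    · exact hne'' hcc
    · exact hne'' (by simp [hcc])
  have hrot : ∀ b : Bool, ∃ R : ℝ → ℂ, (∀ t ∈ Set.Ioo (-1 : ℝ) 1, ‖R t‖ = 1) ∧
      ∀ t ∈ Set.Ioo (-1 : ℝ) 1, ∀ u v (h : G.Adj u v), c ⟨s(u, v), h⟩ = b →
        ψ t u - ψ t v = R t * (ψ 0 u - ψ 0 v) := by
    intro b
    obtain ⟨⟨e, he⟩, hce⟩ := hc b
    induction e with
    | h x y =>
      have he' : G.Adj x y := he
      refine ⟨fun t => (ψ t x - ψ t y) / (ψ 0 x - ψ 0 y), fun t ht => ?_, fun t ht u v h hb => ?_⟩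
      · rw [norm_div, hψ t ht x y he, hψ 0 h0mem x y he, div_self (hne x y he)]
      · have h1 := hconst u v x y h he (hb.trans hce.symm) t ht
        have h2 := hψne t ht x y he
        have h3 := hψne 0 h0mem x y he
        rw [div_eq_div_iff h2 h3] at h1
        rw [div_mul_eq_mul_div, eq_div_iff h3, h1, mul_comm]
  obtain ⟨R, hR, hR'⟩ := hrot true
  obtain ⟨B, hB, hB'⟩ := hrot false
  -- If the two rotations always agreed, the whole connected graph would rotate as one body and the
  -- motion would be trivial.
  have hRB : ∃ t ∈ Set.Ioo (-1 : ℝ) 1, R t ≠ B t := by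
    by_contra! hRB
    refine hnt fun t ht u v => ?_
    have hall : ∀ {u v : V} (w : G.Walk u v), ψ t u - ψ t v = R t * (ψ 0 u - ψ 0 v) := by
      intro u v w
      induction w with
      | nil => simp
      | @cons u x v h w ih =>
        have h1 : ψ t u - ψ t x = R t * (ψ 0 u - ψ 0 x) := by
          cases hcol : c ⟨s(u, x), h⟩
          · rw [hRB t ht]; exact hB' t ht u x h hcol
          · exact hR' t ht u x h hcol
        linear_combination h1 + ih
    obtain ⟨w⟩ := hconn.preconnected u v
    rw [← hnorm, hall w, norm_mul, hR t ht, one_mul, hnorm, hφ0]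
  obtain ⟨t, ht, hne'⟩ := hRB
  intro u w
  have hz := weightedSum_eq_zero_of_rotation (ψ 0) (ψ t) c (R t) (B t) hne' (fun u v h => by
    split_ifs with hcol
    · exact hR' t ht u v h hcol
    · exact hB' t ht u v h (by simpa using hcol)) w
  -- Real parts at time 0 are the first coordinates of `p`.
  have hre := w.map_weightedSum (redWeight c) (ψ 0) Complex.reAddGroupHom
  rw [hz, map_zero] at hre
  rw [hre]
  congr 1
  ext v
  simp [ψ, hLre, hφ0]

end NACFlex
-- Counting NAC-colourings and restricting them to subgraphs
namespace NACFlex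
open SimpleGraph

section Balanced
variable {V W : Type*} {G : SimpleGraph V} {H : SimpleGraph W}

/-- The condition on cycles in the definition of NAC-colourings. -/
def IsBalanced (c : G.edgeSet → Bool) {u v : V} (w : G.Walk u v) : Prop :=
  (∃ b : Bool, ∀ e : G.edgeSet, (e : Sym2 V) ∈ w.edges → c e = b) ∨
    (2 ≤ colourCount c w true ∧ 2 ≤ colourCount c w false)

theorem mapEdgeSet_mem_edges_map (f : H →g G) (hf : Function.Injective f) {u v : W}
    (w : H.Walk u v) (e : H.edgeSet) :
    (f.mapEdgeSet e : Sym2 V) ∈ (w.map f).edges ↔ (e : Sym2 W) ∈ w.edges := by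
  rw [Walk.edges_map]
  exact List.mem_map_of_injective (Sym2.map.injective hf)

theorem exists_of_mem_edges_map (f : H →g G) {u v : W} (w : H.Walk u v) (e : G.edgeSet)
    (he : (e : Sym2 V) ∈ (w.map f).edges) : ∃ e' : H.edgeSet, f.mapEdgeSet e' = e := by
  rw [Walk.edges_map, List.mem_map] at he
  obtain ⟨e', he', h⟩ := he
  exact ⟨⟨e', w.edges_subset_edgeSet he'⟩, Subtype.ext h⟩

theorem colourCount_map (f : H →g G) (hf : Function.Injective f) (c : G.edgeSet → Bool) {u v : W}
    (w : H.Walk u v) (b : Bool) :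
    colourCount c (w.map f) b = colourCount (c ∘ f.mapEdgeSet) w b := by
  rw [colourCount, colourCount, ← Set.ncard_image_of_injective _ (Hom.mapEdgeSet.injective f hf)]
  congr 1
  ext e
  constructor
  · rintro ⟨he, hb⟩
    obtain ⟨e', rfl⟩ := exists_of_mem_edges_map f w e he
    exact ⟨e', ⟨(mapEdgeSet_mem_edges_map f hf w e').1 he, hb⟩, rfl⟩
  · rintro ⟨e', ⟨he, hb⟩, rfl⟩
    exact ⟨(mapEdgeSet_mem_edges_map f hf w e').2 he, hb⟩

theorem isBalanced_map_iff (f : H →g G) (hf : Function.Injective f) (c : G.edgeSet → Bool)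
    {u v : W} (w : H.Walk u v) :
    IsBalanced c (w.map f) ↔ IsBalanced (c ∘ f.mapEdgeSet) w := by
  unfold IsBalanced
  rw [colourCount_map f hf, colourCount_map f hf]
  refine or_congr (exists_congr fun b => ?_) Iff.rfl
  constructor
  · intro h e he
    exact h _ ((mapEdgeSet_mem_edges_map f hf w e).2 he)
  · intro h e he
    obtain ⟨e', rfl⟩ := exists_of_mem_edges_map f w e he
    exact h e' ((mapEdgeSet_mem_edges_map f hf w e').1 he)

theorem colourCount_not (c : G.edgeSet → Bool) {u v : V} (w : G.Walk u v) (b : Bool) :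
    colourCount (fun e => !c e) w b = colourCount c w (!b) := by
  simp [colourCount, Bool.not_eq_eq_eq_not]

theorem IsNACColouring.compl {c : G.edgeSet → Bool} (hc : IsNACColouring G c) :
    IsNACColouring G fun e => !c e := by
  refine ⟨fun b => (hc.1 (!b)).imp fun e he => by simp [he], fun v w hw => ?_⟩
  rw [colourCount_not, colourCount_not]
  refine (hc.2 v w hw).imp (fun ⟨b, hb⟩ => ⟨!b, fun e he => by simp [hb e he]⟩) And.symm

theorem nnac_eq_zero_iff [Finite V] : nnac G = 0 ↔ ∀ c, ¬ IsNACColouring G c := by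
  simp [nnac, Finite.card_eq_zero_iff, isEmpty_subtype]

/-- Swapping colours has no fixed point, since surjectivity provides an edge; two NAC-colourings in
all therefore form one complementary pair. -/
theorem nnac_eq_one_iff [Finite V] : nnac G = 1 ↔ ∃ c, IsNACColouring G c ∧
    ∀ c', IsNACColouring G c' → c' = c ∨ c' = fun e => !c e := by
  have hne : ∀ c, IsNACColouring G c → (fun e => !c e) ≠ c := by
    intro c hc h
    obtain ⟨e, -⟩ := hc.1 true
    simpa using congrFun h e
  have h2 : nnac G = 1 ↔ Nat.card {c : G.edgeSet → Bool // IsNACColouring G c} = 2 := by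
    rw [nnac, div_eq_one_iff_eq two_ne_zero]
    norm_cast
  rw [h2, Nat.card_eq_two_iff]
  constructor
  · rintro ⟨⟨x, hx⟩, ⟨y, hy⟩, hxy, hall⟩
    have hmem : ∀ c, IsNACColouring G c → c = x ∨ c = y := fun c hc => by
      have h : (⟨c, hc⟩ : {c : G.edgeSet → Bool // IsNACColouring G c}) ∈
        ({⟨x, hx⟩, ⟨y, hy⟩} : Set _) := hall ▸ Set.mem_univ _
      simpa [Subtype.ext_iff] using h
    have hy' : (fun e => !x e) = y := (hmem _ hx.compl).resolve_left (hne x hx)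
    exact ⟨x, hx, fun c hc => hy' ▸ hmem c hc⟩
  · rintro ⟨c, hc, hall⟩
    refine ⟨⟨c, hc⟩, ⟨_, hc.compl⟩, fun h => hne c hc (congrArg Subtype.val h).symm, ?_⟩
    refine Set.eq_univ_of_forall fun ⟨d, hd⟩ => ?_
    simpa [Subtype.ext_iff] using hall d hd

end Balanced

/-! ### One-vertex sums and cut vertices -/

section OneSum
variable {V : Type*} {G : SimpleGraph V}

/-- The edge set of `G` is partitioned into two nonempty sets, and at most the vertex `v` is
incident with edges of both. -/
structure IsOneSum (G : SimpleGraph V) (E₁ E₂ : Set (Sym2 V)) (v : V) : Prop where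
  nonempty_left : E₁.Nonempty
  nonempty_right : E₂.Nonempty
  disjoint : Disjoint E₁ E₂
  union_eq : E₁ ∪ E₂ = G.edgeSet
  eq_of_mem : ∀ x ∈ (edgeInduced G E₁).verts, x ∈ (edgeInduced G E₂).verts → x = v

variable {E₁ E₂ : Set (Sym2 V)} {v : V}

theorem IsOneSum.symm (h : IsOneSum G E₁ E₂ v) : IsOneSum G E₂ E₁ v :=
  ⟨h.nonempty_right, h.nonempty_left, h.disjoint.symm, Set.union_comm E₁ E₂ ▸ h.union_eq,
    fun x h₂ h₁ => h.eq_of_mem x h₁ h₂⟩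

theorem IsOneSum.mem_or_mem (h : IsOneSum G E₁ E₂ v) {e : Sym2 V} (he : e ∈ G.edgeSet) :
    e ∈ E₁ ∨ e ∈ E₂ := by
  rwa [← h.union_eq] at he

/-- A walk can pass from one part to the other only at `v`. The last vertex may be `v`, since no
further step leaves it. -/
theorem IsOneSum.edges_subset_of_mem (h : IsOneSum G E₁ E₂ v) {y b : V} (p : G.Walk y b) {x : V}
    (hxy : G.Adj x y) (hp : v ∉ p.support.dropLast) (he : s(x, y) ∈ E₁) :
    ∀ e ∈ p.edges, e ∈ E₁ := by
  induction p generalizing x with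
  | nil => simp
  | @cons y z b hyz q ih =>
    rw [Walk.support_cons, List.dropLast_cons_of_ne_nil q.support_ne_nil, List.mem_cons,
      not_or] at hp
    have hyz' : s(y, z) ∈ E₁ := by
      refine (h.mem_or_mem hyz).resolve_right fun h₂ => hp.1 (h.eq_of_mem y ⟨x, hxy.symm, ?_⟩
        ⟨z, hyz, h₂⟩).symm
      rwa [Sym2.eq_swap]
    rw [Walk.edges_cons]
    simp only [List.mem_cons, forall_eq_or_imp]
    exact ⟨hyz', ih hyz hp.2 hyz'⟩

theorem IsOneSum.cycle_subset (h : IsOneSum G E₁ E₂ v) {u : V} (w : G.Walk u u) (hw : w.IsCycle) :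
    (∀ e ∈ w.edges, e ∈ E₁) ∨ (∀ e ∈ w.edges, e ∈ E₂) := by
  classical
  -- A cycle through `v` can be rotated to start there; it then meets `v` only at its ends and never
  -- changes part.
  have key : ∀ {u : V} (w : G.Walk u u), w.IsCycle → (v ∈ w.support → v = u) →
      (∀ e ∈ w.edges, e ∈ E₁) ∨ (∀ e ∈ w.edges, e ∈ E₂) := by
    intro u w hw hv
    cases w with
    | nil => exact absurd rfl hw.ne_nil
    | @cons _ y _ hxy p =>
      have hnd : p.support.Nodup := by simpa using hw.support_nodup
      have hp : v ∉ p.support.dropLast := by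
        intro hmem
        have hvu := hv (by simp [List.mem_of_mem_dropLast hmem])
        rw [← List.dropLast_append_getLast p.support_ne_nil, p.getLast_support] at hnd
        exact (List.nodup_append.1 hnd).2.2 v hmem u (by simp) hvu
      rcases h.mem_or_mem (show s(u, y) ∈ G.edgeSet from hxy) with he | he
      · exact Or.inl (by simpa [he] using h.edges_subset_of_mem p hxy hp he)
      · exact Or.inr (by simpa [he] using h.symm.edges_subset_of_mem p hxy hp he)
  by_cases hv : v ∈ w.support
  · have hr := key (w.rotate v hv) (hw.rotate hv) fun _ => rfl
    have hmem : ∀ e, e ∈ (w.rotate v hv).edges ↔ e ∈ w.edges := fun e =>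
      (w.rotate_edges v hv).mem_iff
    simpa only [hmem] using hr
  · exact key w hw fun h => absurd h hv

/-- Walks with all edges in `E` come from the subgraph induced by `E`. -/
theorem exists_walk_edgeInduced (E : Set (Sym2 V)) {u b : V} (p : G.Walk u b)
    (hp : ∀ e ∈ p.edges, e ∈ E) (hu : u ∈ (edgeInduced G E).verts) :
    ∃ (hb : b ∈ (edgeInduced G E).verts) (q : (edgeInduced G E).coe.Walk ⟨u, hu⟩ ⟨b, hb⟩),
      q.map (edgeInduced G E).hom = p := by
  induction p with
  | nil => exact ⟨hu, .nil, rfl⟩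
  | @cons u x b hux p ih =>
    simp only [Walk.edges_cons, List.mem_cons, forall_eq_or_imp] at hp
    have hadj : (edgeInduced G E).Adj u x := ⟨hux, hp.1⟩
    obtain ⟨hb, q, hq⟩ := ih hp.2 hadj.snd_mem
    refine ⟨hb, .cons (show (edgeInduced G E).coe.Adj ⟨u, hu⟩ ⟨x, hadj.snd_mem⟩ from hadj) q, ?_⟩
    rw [Walk.map_cons, hq]
    rfl

/-- The restriction of a colouring to an edge-induced subgraph. -/
def restrictColouring (c : G.edgeSet → Bool) (E : Set (Sym2 V)) :
    (edgeInduced G E).coe.edgeSet → Bool :=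
  c ∘ (edgeInduced G E).hom.mapEdgeSet

theorem isBalanced_of_restrict (c : G.edgeSet → Bool) (E : Set (Sym2 V))
    (hE : ∀ x (w : (edgeInduced G E).coe.Walk x x), w.IsCycle →
      IsBalanced (restrictColouring c E) w)
    {u : V} (w : G.Walk u u) (hw : w.IsCycle) (hwE : ∀ e ∈ w.edges, e ∈ E) : IsBalanced c w := by
  have hu : u ∈ (edgeInduced G E).verts := by
    cases w with
    | nil => exact absurd rfl hw.ne_nil
    | cons h p => exact ⟨_, h, hwE _ (by simp)⟩
  obtain ⟨_, q, hq⟩ := exists_walk_edgeInduced E w hwE hu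
  have hinj := (edgeInduced G E).hom_injective
  have hcyc : (q.map (edgeInduced G E).hom).IsCycle := by rw [hq]; exact hw
  have hbal : IsBalanced c (q.map (edgeInduced G E).hom) → IsBalanced c w := by
    rw [hq]; exact id
  exact hbal <| (isBalanced_map_iff _ hinj c q).2
    (hE _ q ((Walk.isCycle_map_iff_of_injective hinj).1 hcyc))

theorem isBalanced_restrict (c : G.edgeSet → Bool) (E : Set (Sym2 V))
    (hc : ∀ x (w : G.Walk x x), w.IsCycle → IsBalanced c w)
    {x} (w : (edgeInduced G E).coe.Walk x x) (hw : w.IsCycle) :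
    IsBalanced (restrictColouring c E) w := by
  have hinj := (edgeInduced G E).hom_injective
  exact (isBalanced_map_iff _ hinj c w).1 (hc _ _ ((Walk.isCycle_map_iff_of_injective hinj).2 hw))

theorem exists_mapEdgeSet_eq {E : Set (Sym2 V)} (e : G.edgeSet) :
    (∃ e' : (edgeInduced G E).coe.edgeSet, (edgeInduced G E).hom.mapEdgeSet e' = e) ↔
      (e : Sym2 V) ∈ E := by
  obtain ⟨e, he⟩ := e
  induction e with
  | h x y =>
    constructor
    · rintro ⟨⟨e', he'⟩, h⟩
      induction e' with
      | h a b =>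
        rw [← h]
        exact he'.2
    · intro hE
      have hadj : (edgeInduced G E).Adj x y := ⟨he, hE⟩
      exact ⟨⟨s(⟨x, hadj.fst_mem⟩, ⟨y, hadj.snd_mem⟩), hadj⟩, rfl⟩

/-- The colouring which is `true` exactly on one part of the edges. -/
noncomputable def partColouring (G : SimpleGraph V) (E : Set (Sym2 V)) : G.edgeSet → Bool :=
  open Classical in fun e => decide ((e : Sym2 V) ∈ E)

theorem IsOneSum.isNACColouring_partColouring (h : IsOneSum G E₁ E₂ v) :
    IsNACColouring G (partColouring G E₁) := by
  refine ⟨?_, fun u w hw => Or.inl ?_⟩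
  · have hsub := h.union_eq.subset
    obtain ⟨e₁, he₁⟩ := h.nonempty_left
    obtain ⟨e₂, he₂⟩ := h.nonempty_right
    rintro (_ | _)
    · exact ⟨⟨e₂, hsub (Or.inr he₂)⟩, by
        simpa [partColouring] using fun he => h.disjoint.notMem_of_mem_left he he₂⟩
    · exact ⟨⟨e₁, hsub (Or.inl he₁)⟩, by simpa [partColouring] using he₁⟩
  · rcases h.cycle_subset w hw with hE | hE
    · exact ⟨true, fun e he => by simpa [partColouring] using hE e he⟩
    · exact ⟨false, fun e he => by
        simpa [partColouring] using h.disjoint.notMem_of_mem_right (hE e he)⟩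

/-- A part of a one-vertex sum with a unique pair of NAC-colourings has none: such a colouring
would extend to the whole graph, while all NAC-colourings are constant on the part. -/
theorem IsOneSum.nnac_left_eq_zero [Finite V] (h : IsOneSum G E₁ E₂ v) (hG : nnac G = 1) :
    nnac (edgeInduced G E₁).coe = 0 := by
  classical
  obtain ⟨c₀, -, huniq⟩ := nnac_eq_one_iff.1 hG
  -- The part colouring is one of the only two NAC-colourings, and both it and its complement are
  -- constant on `E₁`.
  have hconst : ∀ c, IsNACColouring G c → ∀ e f : G.edgeSet, (e : Sym2 V) ∈ E₁ →
      (f : Sym2 V) ∈ E₁ → c e = c f := by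
    have hpart : ∀ e f : G.edgeSet, (e : Sym2 V) ∈ E₁ → (f : Sym2 V) ∈ E₁ → c₀ e = c₀ f := by
      intro e f he hf
      rcases huniq _ h.isNACColouring_partColouring with h' | h' <;>
        have h₁ := congrFun h' e <;> have h₂ := congrFun h' f <;>
        simp_all [partColouring]
    intro c hc e f he hf
    rcases huniq c hc with rfl | rfl
    · exact hpart e f he hf
    · simp [hpart e f he hf]
  refine nnac_eq_zero_iff.2 fun d hd => ?_
  let F := (edgeInduced G E₁).hom.mapEdgeSet
  have hF : Function.Injective F := Hom.mapEdgeSet.injective _ (edgeInduced G E₁).hom_injective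
  -- The extension of `d` by `false` on the other part.
  let c : G.edgeSet → Bool := fun e => decide (∃ e', F e' = e ∧ d e' = true)
  have hc₁ : restrictColouring c E₁ = d := by
    funext e
    change decide (∃ e', F e' = F e ∧ d e' = true) = d e
    simp only [hF.eq_iff, exists_eq_left, Bool.decide_eq_true]
  have hcd : ∀ e, c (F e) = d e := fun e => congrFun hc₁ e
  have hc : IsNACColouring G c := by
    refine ⟨fun b => (hd.1 b).elim fun e he => ⟨F e, (hcd e).trans he⟩, fun u w hw => ?_⟩
    rcases h.cycle_subset w hw with hE | hE
    · exact isBalanced_of_restrict c E₁ (hc₁ ▸ hd.2) w hw hE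
    · refine Or.inl ⟨false, fun e he => ?_⟩
      simp only [c, decide_eq_false_iff_not]
      rintro ⟨e', he', -⟩
      exact h.disjoint.notMem_of_mem_right (hE e he) ((exists_mapEdgeSet_eq e).1 ⟨e', he'⟩)
  obtain ⟨e, he⟩ := hd.1 true
  obtain ⟨f, hf⟩ := hd.1 false
  have := hconst c hc (F e) (F f) ((exists_mapEdgeSet_eq _).1 ⟨e, rfl⟩)
    ((exists_mapEdgeSet_eq _).1 ⟨f, rfl⟩)
  simp [hcd, he, hf] at this

/-- The restriction inherits the cycle condition, so two colours on `E` would make it a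
NAC-colouring of the part. -/
theorem IsNACColouring.eq_of_nnac_edgeInduced_eq_zero [Finite V] {c : G.edgeSet → Bool}
    (hc : IsNACColouring G c) {E : Set (Sym2 V)} (hE : nnac (edgeInduced G E).coe = 0)
    (e f : G.edgeSet) (he : (e : Sym2 V) ∈ E) (hf : (f : Sym2 V) ∈ E) : c e = c f := by
  by_contra hne
  refine nnac_eq_zero_iff.1 hE (restrictColouring c E) ⟨?_, fun u w hw =>
    isBalanced_restrict c E hc.2 w hw⟩
  obtain ⟨e', rfl⟩ := (exists_mapEdgeSet_eq e).2 he
  obtain ⟨f', rfl⟩ := (exists_mapEdgeSet_eq f).2 hf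
  intro b
  by_cases hb : restrictColouring c E e' = b
  · exact ⟨e', hb⟩
  · refine ⟨f', ?_⟩
    change c _ = b
    change ¬ c _ = b at hb
    revert hne hb
    generalize c _ = x, c _ = y
    revert x y b
    decide

/-- A NAC-colouring is constant on each part, and surjectivity makes the two constants differ; only
the part colouring and its complement remain. -/
theorem IsOneSum.nnac_eq_one [Finite V] (h : IsOneSum G E₁ E₂ v)
    (h₁ : nnac (edgeInduced G E₁).coe = 0) (h₂ : nnac (edgeInduced G E₂).coe = 0) :
    nnac G = 1 := by
  refine nnac_eq_one_iff.2 ⟨_, h.isNACColouring_partColouring, fun c hc => ?_⟩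
  obtain ⟨e₁, he₁⟩ := h.nonempty_left
  obtain ⟨e₂, he₂⟩ := h.nonempty_right
  let f₁ : G.edgeSet := ⟨e₁, h.union_eq.subset (Or.inl he₁)⟩
  let f₂ : G.edgeSet := ⟨e₂, h.union_eq.subset (Or.inr he₂)⟩
  have hc₁ : ∀ e : G.edgeSet, (e : Sym2 V) ∈ E₁ → c e = c f₁ := fun e he =>
    hc.eq_of_nnac_edgeInduced_eq_zero h₁ e f₁ he he₁
  have hc₂ : ∀ e : G.edgeSet, (e : Sym2 V) ∈ E₂ → c e = c f₂ := fun e he =>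
    hc.eq_of_nnac_edgeInduced_eq_zero h₂ e f₂ he he₂
  have hmem : ∀ e : G.edgeSet, (e : Sym2 V) ∈ E₁ ∧ (e : Sym2 V) ∉ E₂ ∨
      (e : Sym2 V) ∈ E₂ ∧ (e : Sym2 V) ∉ E₁ := fun e => (h.mem_or_mem e.2).imp
    (fun he => ⟨he, h.disjoint.notMem_of_mem_left he⟩)
    (fun he => ⟨he, h.disjoint.notMem_of_mem_right he⟩)
  have hne : c f₁ ≠ c f₂ := by
    intro heq
    obtain ⟨e, he⟩ := hc.1 (!c f₁)
    rcases hmem e with ⟨h', -⟩ | ⟨h', -⟩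
    · simp [hc₁ e h'] at he
    · simp [hc₂ e h', heq] at he
  cases hcf : c f₁
  · right
    have hcf₂ : c f₂ = true := by simpa [hcf] using hne.symm
    ext e
    rcases hmem e with ⟨h', h''⟩ | ⟨h', h''⟩
    · simp [partColouring, hc₁ e h', hcf, h']
    · simp [partColouring, hc₂ e h', hcf₂, h'']
  · left
    have hcf₂ : c f₂ = false := by simpa [hcf] using hne.symm
    ext e
    rcases hmem e with ⟨h', h''⟩ | ⟨h', h''⟩
    · simp [partColouring, hc₁ e h', hcf, h']
    · simp [partColouring, hc₂ e h', hcf₂, h'']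

/-- If the edges at each vertex had one colour, that colour would propagate along walks to the whole
connected graph. -/
theorem exists_adj_colour_ne (hconn : G.Connected) (c : G.edgeSet → Bool)
    (hc : Function.Surjective c) : ∃ v u w, ∃ (hu : G.Adj v u) (hw : G.Adj v w),
      c ⟨s(v, u), hu⟩ ≠ c ⟨s(v, w), hw⟩ := by
  by_contra! hall
  have key : ∀ {x z : V} (_ : G.Walk x z) {y t : V} (hy : G.Adj x y) (ht : G.Adj z t),
      c ⟨s(x, y), hy⟩ = c ⟨s(z, t), ht⟩ := by
    intro x z p
    induction p with
    | nil => exact fun hy ht => hall _ _ _ hy ht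
    | @cons x x' z h p ih =>
      intro y t hy ht
      rw [hall _ _ _ hy h, ← ih h.symm ht]
      congr 2
      exact Sym2.eq_swap
  obtain ⟨⟨e, he⟩, hce⟩ := hc true
  obtain ⟨⟨f, hf⟩, hcf⟩ := hc false
  induction e with
  | h x y =>
    induction f with
    | h z t =>
      obtain ⟨p⟩ := hconn.preconnected x z
      have := key p he hf
      rw [hce, hcf] at this
      exact absurd this (by decide)

/-- A vertex `v` with two neighbours not joined by a walk avoiding `v` yields a separation. -/
theorem exists_isSeparation {u w : V} (hu : G.Adj v u) (hw : G.Adj v w)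
    (hq : ∀ q : G.Walk u w, v ∈ q.support) :
    ∃ E₁ E₂ : Set (Sym2 V), IsOneSum G E₁ E₂ v ∧
      IsSeparation G (edgeInduced G E₁) (edgeInduced G E₂) ∧
      edgeInduced G E₁ ⊓ edgeInduced G E₂ = G.singletonSubgraph v := by
  -- The component of `u` after deleting `v`. It can be left only through `v`, so the edges meeting
  -- it share no vertex but `v` with the others.
  let A : Set V := {x | ∃ q : G.Walk u x, v ∉ q.support}
  have huA : u ∈ A := ⟨.nil, by simpa using hu.ne⟩
  have hwA : w ∉ A := fun ⟨q, h⟩ => h (hq q)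
  have hvA : v ∉ A := fun ⟨q, h⟩ => h q.end_mem_support
  have hstep : ∀ x y, G.Adj x y → x ∈ A → y ≠ v → y ∈ A := by
    rintro x y hxy ⟨q, hq⟩ hy
    exact ⟨q.concat hxy, by simpa [Walk.support_concat, hq] using hy.symm⟩
  let E₁ : Set (Sym2 V) := {e | e ∈ G.edgeSet ∧ ∃ x ∈ A, x ∈ e}
  let E₂ : Set (Sym2 V) := {e | e ∈ G.edgeSet ∧ ∀ x ∈ A, x ∉ e}
  have hE₁ : ∀ x y, G.Adj x y → (s(x, y) ∈ E₁ ↔ x ∈ A ∨ y ∈ A) := by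
    intro x y h
    simp [E₁, h, and_or_left, exists_or]
  have hE₂ : ∀ x y, G.Adj x y → (s(x, y) ∈ E₂ ↔ x ∉ A ∧ y ∉ A) := by
    intro x y h
    constructor
    · exact fun h' => ⟨fun hx => h'.2 x hx (by simp), fun hy => h'.2 y hy (by simp)⟩
    · rintro ⟨hx, hy⟩
      refine ⟨h, fun z hz hzm => ?_⟩
      rcases Sym2.mem_iff.1 hzm with rfl | rfl
      exacts [hx hz, hy hz]
  have hvu : s(v, u) ∈ E₁ := (hE₁ v u hu).2 (Or.inr huA)
  have hvw : s(v, w) ∈ E₂ := (hE₂ v w hw).2 ⟨hvA, hwA⟩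
  have hdisj : Disjoint E₁ E₂ := Set.disjoint_left.2 fun e ⟨_, x, hx, hxe⟩ h' => h'.2 x hx hxe
  have hunion : E₁ ∪ E₂ = G.edgeSet := by
    ext e
    refine ⟨fun h => h.elim And.left And.left, fun h => ?_⟩
    by_cases hA : ∃ x ∈ A, x ∈ e
    · exact Or.inl ⟨h, hA⟩
    · push Not at hA
      exact Or.inr ⟨h, hA⟩
  have hinter : ∀ x ∈ (edgeInduced G E₁).verts, x ∈ (edgeInduced G E₂).verts → x = v := by
    rintro x ⟨y, hxy, h₁⟩ ⟨z, hxz, h₂⟩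
    by_contra hxv
    have hxA := ((hE₂ x z hxz).1 h₂).1
    exact hxA (hstep y x hxy.symm (((hE₁ x y hxy).1 h₁).resolve_left hxA) hxv)
  have hv₁ : v ∈ (edgeInduced G E₁).verts := ⟨u, hu, hvu⟩
  have hv₂ : v ∈ (edgeInduced G E₂).verts := ⟨w, hw, hvw⟩
  have hu₁ : u ∈ (edgeInduced G E₁).verts := ⟨v, hu.symm, by rwa [Sym2.eq_swap]⟩
  have hw₂ : w ∈ (edgeInduced G E₂).verts := ⟨v, hw.symm, by rwa [Sym2.eq_swap]⟩
  refine ⟨E₁, E₂, ⟨⟨_, hvu⟩, ⟨_, hvw⟩, hdisj, hunion, hinter⟩,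
    ⟨⟨E₁, E₂, ⟨_, hvu⟩, ⟨_, hvw⟩, hdisj, hunion, rfl, rfl⟩,
      ⟨u, hu₁, fun h => hu.ne' (hinter u hu₁ h)⟩, ⟨w, hw₂, fun h => hw.ne' (hinter w h hw₂)⟩⟩, ?_⟩
  ext x y
  · simp only [Subgraph.verts_inf, Set.mem_inter_iff, singletonSubgraph_verts,
      Set.mem_singleton_iff]
    exact ⟨fun h => hinter x h.1 h.2, fun h => h ▸ ⟨hv₁, hv₂⟩⟩
  · simp only [Subgraph.inf_adj, singletonSubgraph_adj]
    exact ⟨fun h => hdisj.notMem_of_mem_left h.1.2 h.2.2, fun h => absurd h (by simp)⟩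

end OneSum

end NACFlex

theorem proposition5p10 {V : Type*} [Finite V] (G : SimpleGraph V) (hconn : G.Connected)
    (hflex : NACFlex.IsFlexible G) :
    NACFlex.nnac G = 1 ↔
      ∃ G₁ G₂ : G.Subgraph, NACFlex.IsSeparation G G₁ G₂ ∧
        (∃ v : V, G₁ ⊓ G₂ = G.singletonSubgraph v) ∧
        NACFlex.nnac G₁.coe = 0 ∧ NACFlex.nnac G₂.coe = 0 := by
  open NACFlex in
  constructor
  · intro hG
    obtain ⟨c, hc, huniq⟩ := nnac_eq_one_iff.1 hG
    obtain ⟨v, u, w, hu, hw, hne⟩ := exists_adj_colour_ne hconn c hc.1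
    obtain ⟨E₁, E₂, hsum, hsep, hinf⟩ := exists_isSeparation hu hw fun q => by
      by_contra hq
      exact hne (colour_eq_of_unique_nac hconn hflex c hc.1 huniq hu hw q hq)
    exact ⟨_, _, hsep, ⟨v, hinf⟩, hsum.nnac_left_eq_zero hG, hsum.symm.nnac_left_eq_zero hG⟩
  · rintro ⟨_, _, ⟨⟨E₁, E₂, hne₁, hne₂, hdisj, hunion, rfl, rfl⟩, -⟩, ⟨v, hv⟩, h₁, h₂⟩
    have hsum : IsOneSum G E₁ E₂ v := ⟨hne₁, hne₂, hdisj, hunion, fun x hx₁ hx₂ => by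
      have hx : x ∈ (edgeInduced G E₁ ⊓ edgeInduced G E₂).verts := ⟨hx₁, hx₂⟩
      rwa [hv] at hx⟩
    exact hsum.nnac_eq_one h₁ h₂
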